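/- Let $M$ be a loopless matroid of rank $d+1$ on a finite set $E$. Let $A_{FY}^\bullet(M)$ be its Chow ring, the quotient of $\mathbb R[z_F : F \text{ a nonempty flat of } M]$ by the ideal generated by the products $z_Fz_{F'}$ for incomparable $F,F'$ and the sums $\sum_{F\supseteq a} z_F$ for all flats $a$ of rank $1$. Its simplicial presentation $A_\nabla^\bullet(M)$ is the quotient of $\mathbb R[h_F : F \text{ a nonempty flat of } M]$ by the kernel of the map $h_F\mapsto -\sum_{G\supseteq F} z_G$ to $A_{FY}^\bullet(M)$. There is a unique linear map $\int_M : A^d(M)\to\mathbb R$ (the degree map) with $\int_M z_{F_1}\cdots z_{F_d}=1$ for every maximal chain $F_1\subsetneq\cdots\subsetneq F_d$ of nonempty proper flats. Extend it coefficientwise to polynomials in variables $t_F$, and let $$VP_M^\nabla(\underline t) := \int_M \Big(\sum_F t_F h_F\Big)^d$$ be the volume polynomial of $A_\nabla^\bullet(M)$, where $F$ runs over the nonempty flats of $M$. A collection $A_1,\dots,A_d$ of subsets of $E$ (repetitions allowed) is said to satisfy the dragon Hall–Rado condition $\operatorname{DHR}(M)$ if $$\operatorname{rk}_M\Big(\bigcup_{j\in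 J} A_j\Big)\ \ge\ |J|+1\qquad\text{for every } \emptyset\subsetneq J\subseteq\{1,\dots,d\}.$$ Then $$VP_M^\nabla(\underline t)=\sum_{(F_1,\dots,F_d)} t_{F_1}\cdots t_{F_d},$$ where the sum is over ordered $d$-tuples of nonempty flats satisfying $\operatorname{DHR}(M)$. Equivalently, $$VP_M^\nabla(\underline t)=\sum_{\{F_1^{d_1},\dots,F_k^{d_k}\}}\binom{d}{d_1,\dots,d_k}\, t_{F_1}^{d_1}\cdots t_{F_k}^{d_k},$$ where the sum is over multisets of size $d$ of nonempty flats satisfying $\operatorname{DHR}(M)$. Both formulas also hold when the variables $t_F$, and the flats in the sums, are restricted to the flats $F$ of rank at least $2$. In particular, for the Boolean matroid $U_{n+1,n+1}$ on $\{0,\dots,n\}$, whose nonempty flats are all the nonempty subsets, one recovers Postnikov's formula $$VP^\nabla_{U_{n+1,n+1}}(\underline t)=\sum_{(S_1,\dots,S_n)} t_{S_1}\cdots t_{S_n},$$ where the sum is over ordered collections of nonempty subsets $S_1,\dots,S_n$ of $\{0,\dots,n\}$ such that $\big|\bigcup_{j\in J}S_j\big|\ge |J|+1$ for every $\emptyset\subsetneq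 J\subseteq\{1,\dots,n\}$. -/

import Mathlib

open scoped Classical

noncomputable section

namespace MatroidChow

open MvPolynomial

variable {α : Type*}

/-- The nonempty flats of `M`, ordered by inclusion. -/
abbrev NonemptyFlat (M : Matroid α) : Type _ := {F : Set α // M.IsFlat F ∧ F.Nonempty}

/-- The flats of `M` of rank at least two. -/
abbrev FlatGeTwo (M : Matroid α) : Type _ := {F : NonemptyFlat M // 2 ≤ M.eRk F.1}

/-- The dragon Hall-Rado condition of `M` for an indexed collection of subsets. -/
def DragonHallRado (M : Matroid α) {m : ℕ} (A : Fin m → Set α) : Prop :=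
  ∀ J : Finset (Fin m), J.Nonempty → (J.card : ℕ∞) + 1 ≤ M.eRk (⋃ j ∈ J, A j)

/-- The dragon Hall-Rado condition of `M` for a multiset of subsets: subsets of the index set
become sub-multisets. -/
def DragonHallRadoMultiset (M : Matroid α) (A : Multiset (Set α)) : Prop :=
  ∀ T ≤ A, T ≠ 0 → (T.card : ℕ∞) + 1 ≤ M.eRk (⋃ S ∈ T, S)

/-- The Boolean matroid `U_{n+1,n+1}` on `{0, …, n}`. -/
abbrev boolean (n : ℕ) : Matroid (Fin (n + 1)) := Matroid.freeOn Set.univ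

/-- Every nonempty subset of `{0, …, n}` is a flat of the Boolean matroid. -/
def booleanFlat (n : ℕ) (S : {S : Finset (Fin (n + 1)) // S.Nonempty}) :
    NonemptyFlat (boolean n) :=
  ⟨(S.1 : Set (Fin (n + 1))), by
    refine ⟨?_, by simpa using S.2⟩
    rw [Matroid.isFlat_iff_closure_eq]
    simp⟩

variable [Fintype α]

/-- The ideal of relations of the Chow ring: `z_F z_G` for incomparable nonempty flats `F`, `G`,
and `∑_{F ⊇ a} z_F` for every atom `a` of the lattice of flats (a flat of rank one). -/
def chowIdeal (M : Matroid α) : Ideal (MvPolynomial (NonemptyFlat M) ℝ) :=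
  Ideal.span {p | ∃ F G : NonemptyFlat M, ¬ F ≤ G ∧ ¬ G ≤ F ∧ p = X F * X G} ⊔
  Ideal.span {p | ∃ a : NonemptyFlat M, M.eRk a.1 = 1 ∧
    p = ∑ F : NonemptyFlat M with a ≤ F, X F}

/-- The Chow ring of `M` in the Feichtner-Yuzvinsky presentation. -/
abbrev ChowFY (M : Matroid α) : Type _ := MvPolynomial (NonemptyFlat M) ℝ ⧸ chowIdeal M

/-- The generator `z_F`. -/
def z (M : Matroid α) (F : NonemptyFlat M) : ChowFY M := Ideal.Quotient.mk (chowIdeal M) (X F)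

/-- The degree `k` part of the Chow ring. -/
def gradedPiece (M : Matroid α) (k : ℕ) : Submodule ℝ (ChowFY M) :=
  (homogeneousSubmodule (NonemptyFlat M) ℝ k).map
    (Ideal.Quotient.mkₐ ℝ (chowIdeal M)).toLinearMap

/-- `deg` is the degree map of a matroid `M` of rank `d + 1`, extended by zero to the parts of
degree different from `d`: it takes the value `1` on `z_{F_1} ⋯ z_{F_d}` for every maximal chain
`F_1 ⊂ ⋯ ⊂ F_d` of nonempty proper flats (these chains have exactly `d` members). -/
def IsDegreeMap (M : Matroid α) (d : ℕ) (deg : ChowFY M →ₗ[ℝ] ℝ) : Prop :=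
  (∀ k, k ≠ d → ∀ ξ ∈ gradedPiece M k, deg ξ = 0) ∧
  ∀ F : Fin d → NonemptyFlat M, StrictMono F → (∀ i, (F i).1 ≠ M.E) → deg (∏ i, z M (F i)) = 1

/-- The degree map `∫_M`, by definite description. It is meaningful when `IsDegreeMap M d` has
exactly one solution, as it has when `M` is loopless of rank `d + 1`. -/
def degreeMap (M : Matroid α) (d : ℕ) : ChowFY M →ₗ[ℝ] ℝ := Classical.epsilon (IsDegreeMap M d)

/-- The map `ℝ[h_F] → A_FY(M)`, `h_F ↦ -∑_{G ⊇ F} z_G`. -/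
def simplicialHom (M : Matroid α) : MvPolynomial (NonemptyFlat M) ℝ →ₐ[ℝ] ChowFY M :=
  aeval fun F => -∑ G : NonemptyFlat M with F ≤ G, z M G

/-- The simplicial presentation of the Chow ring. -/
abbrev SimplicialChow (M : Matroid α) : Type _ :=
  MvPolynomial (NonemptyFlat M) ℝ ⧸ RingHom.ker (simplicialHom M)

/-- The simplicial generator `h_F`. -/
def h (M : Matroid α) (F : NonemptyFlat M) : SimplicialChow M :=
  Ideal.Quotient.mk (RingHom.ker (simplicialHom M)) (X F)

/-- The degree map on the simplicial presentation, through the canonical identification of the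
latter with `A_FY(M)`. -/
def simplicialDegree (M : Matroid α) (d : ℕ) : SimplicialChow M →ₗ[ℝ] ℝ :=
  (degreeMap M d).comp (Ideal.kerLiftAlg (simplicialHom M)).toLinearMap

/-- The coefficientwise extension `A[t] → ℝ[t]` of a linear map `A → ℝ`. -/
def mapCoeff {A ι : Type*} [CommRing A] [Algebra ℝ A] (φ : A →ₗ[ℝ] ℝ) (p : MvPolynomial ι A) :
    MvPolynomial ι ℝ :=
  ∑ m ∈ p.support, monomial m (φ (p.coeff m))

/-- The volume polynomial `∫_M (∑_i t_i h_{F_i})^d` in one variable `t_i` for each member of a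
finite family `(F_i)` of nonempty flats. -/
def volumePolynomial (M : Matroid α) (d : ℕ) {ι : Type*} [Fintype ι] (F : ι → NonemptyFlat M) :
    MvPolynomial ι ℝ :=
  mapCoeff (simplicialDegree M d) ((∑ i, X i * C (h M (F i))) ^ d)

end MatroidChow

end

/-!
The degree map is constructed in the simplicial variables `h_F`. The functional on
polynomials in the `h_F` that sends a monomial of degree `d` to `1` or `0`, according to the dragon
Hall-Rado condition, kills every multiple of `h_a` for `a` of rank one
(`dragonFunctional_X_mul_eq_zero`), and every multiple of `(h_F - h_J) (h_G - h_J)`, where `J` is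
the join of `F` and `G` (`dragonFunctional_exchange`). The second fact is a consequence of
submodularity: if one violation of the condition involves `F` and another one involves `G`, then
their union is a violation for the pair `J, J`, or their intersection is a violation without `F` and
`G` (`forall_le_rk_or_forall_le_rk`).
In the variables `z_F` these relations generate the ideal of the Chow ring, because
`(h_F - h_J) (h_G - h_J)` is the sum of the products `z_A z_B` over the flats `A` containing `F` but
not `G` and the flats `B` containing `G` but not `F`
(`dragonFunctional_zForm_mul_zForm`). Hence the functional descends to the Chow ring, with the
prescribed values on products of simplicial generators by construction.

That it is the degree map, and the only one, follows from two facts about the Chow ring. Both rest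
on the vanishing of `z_A h_G ^ m` for `A` not containing `G` and `m ≥ rk G - rk (A ∩ G)`
(`z_mul_hFY_pow_eq_zero`). One is that the product of the `z_F` over a maximal chain of proper flats
is `h_E ^ d` (`prod_z_eq_hFY_pow`), on which the functional takes the value `1`. The other is that
every product of `d` simplicial generators is a multiple of `h_E ^ d` (`exists_prod_hFY_eq_smul`).

The volume polynomial is then computed by expanding the power of the sum, either over ordered tuples
or with multinomial coefficients.
-/

noncomputable section

namespace MatroidChow

open MvPolynomial

variable {α : Type*}

/-! ### Joins of flats -/

/-- The join of two nonempty flats. -/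
def join {M : Matroid α} (F G : NonemptyFlat M) : NonemptyFlat M :=
  ⟨M.closure (F.1 ∪ G.1), M.isFlat_closure _,
    (F.2.2.mono Set.subset_union_left).mono
      (M.subset_closure _ (Set.union_subset F.2.1.subset_ground G.2.1.subset_ground))⟩

lemma join_le_iff {M : Matroid α} {F G J : NonemptyFlat M} :
    join F G ≤ J ↔ F ≤ J ∧ G ≤ J := by
  have hsub : F.1 ∪ G.1 ⊆ M.closure (F.1 ∪ G.1) :=
    M.subset_closure _ (Set.union_subset F.2.1.subset_ground G.2.1.subset_ground)
  constructor
  · intro h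
    exact ⟨Set.subset_union_left.trans (hsub.trans h), Set.subset_union_right.trans (hsub.trans h)⟩
  · rintro ⟨hF, hG⟩
    have := M.closure_subset_closure (Set.union_subset hF hG)
    rwa [J.2.1.closure] at this

/-! ### The dragon Hall-Rado condition -/

lemma le_cons_iff {β : Type*} {a : β} {s T : Multiset β} :
    T ≤ a ::ₘ s ↔ T ≤ s ∨ ∃ T' ≤ s, T = a ::ₘ T' := by
  rw [← Multiset.mem_powerset, Multiset.powerset_cons]
  simp [eq_comm]

lemma exists_map_eq_of_le_map {β γ : Type*} {f : β → γ} {s : Multiset β} {T : Multiset γ}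
    (hT : T ≤ s.map f) : ∃ T' ≤ s, T'.map f = T := by
  induction s using Multiset.induction_on generalizing T with
  | empty => exact ⟨0, le_rfl, by simpa [eq_comm] using hT⟩
  | cons a s ih =>
    rw [Multiset.map_cons] at hT
    obtain hT | ⟨T, hT₁, rfl⟩ := le_cons_iff.1 hT
    · obtain ⟨T', hT', rfl⟩ := ih hT
      exact ⟨T', hT'.trans (Multiset.le_cons_self _ _), rfl⟩
    · obtain ⟨T', hT', rfl⟩ := ih hT₁
      exact ⟨a ::ₘ T', Multiset.cons_le_cons _ hT', by simp⟩

/-- The two forms of the dragon Hall-Rado condition, for indexed collections and for multisets,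
agree. -/
lemma dragonHallRado_iff_multiset (M : Matroid α) {m : ℕ} (A : Fin m → Set α) :
    DragonHallRado M A ↔ DragonHallRadoMultiset M (Finset.univ.val.map A) := by
  constructor
  · intro h T hT hT0
    obtain ⟨J, hJ, rfl⟩ := exists_map_eq_of_le_map hT
    have hnd : J.Nodup := Multiset.nodup_of_le hJ Finset.univ.nodup
    have := h ⟨J, hnd⟩ (by
      rw [Finset.nonempty_iff_ne_empty]
      rintro h0
      apply hT0
      rw [show J = 0 from congrArg Finset.val h0, Multiset.map_zero])
    simpa using this
  · intro h J hJ
    have := h (J.val.map A) (Multiset.map_le_map (Finset.val_le_iff.2 J.subset_univ))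
      (by simpa using hJ.ne_empty)
    simpa using this

/-- The value of the degree map on a product of simplicial generators: `1` or `0`, according to the
dragon Hall-Rado condition. -/
def dragonIndicator (M : Matroid α) (A : Multiset (Set α)) : ℝ :=
  if DragonHallRadoMultiset M A then 1 else 0

/-- Every collection of fewer than `rk M` copies of the ground set satisfies the dragon
Hall-Rado condition. -/
lemma dragonIndicator_replicate_ground (M : Matroid α) {d : ℕ} (hM : M.eRank = (d : ℕ∞) + 1) :
    dragonIndicator M (Multiset.replicate d M.E) = 1 := by
  rw [dragonIndicator, if_pos]
  intro T hT hT0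
  obtain ⟨m, hm, rfl⟩ := Multiset.le_replicate_iff.1 hT
  have hm0 : m ≠ 0 := by rintro rfl; simp at hT0
  have : (⋃ S ∈ Multiset.replicate m M.E, S) = M.E := by
    ext x; simp [Multiset.mem_replicate, hm0]
  rw [this, Matroid.eRk_ground, hM]
  simp only [Multiset.card_replicate]
  gcongr

/-! ### The degree functional in the variables `h_F` -/

/-- The functional on polynomials in the variables `h_F` which sends a monomial of degree `d` to
`1` or `0`, according to the dragon Hall-Rado condition, and vanishes in other degrees. -/
def dragonFunctional (M : Matroid α) (d : ℕ) : MvPolynomial (NonemptyFlat M) ℝ →ₗ[ℝ] ℝ :=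
  (basisMonomials (NonemptyFlat M) ℝ).constr ℝ fun m =>
    if m.degree = d then dragonIndicator M (m.toMultiset.map Subtype.val) else 0

lemma dragonFunctional_monomial (M : Matroid α) (d : ℕ) (m : NonemptyFlat M →₀ ℕ) :
    dragonFunctional M d (monomial m 1) =
      if m.degree = d then dragonIndicator M (m.toMultiset.map Subtype.val) else 0 := by
  have := (basisMonomials (NonemptyFlat M) ℝ).constr_basis ℝ (fun m =>
    if m.degree = d then dragonIndicator M (m.toMultiset.map Subtype.val) else 0) m
  rwa [coe_basisMonomials] at this

lemma prod_map_X_eq_monomial {σ : Type*} [DecidableEq σ] (s : Multiset σ) :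
    (s.map X).prod = (monomial (Multiset.toFinsupp s) 1 : MvPolynomial σ ℝ) := by
  induction s using Multiset.induction_on with
  | empty => simp
  | cons a s ih =>
    rw [Multiset.map_cons, Multiset.prod_cons, ih, ← Multiset.singleton_add, map_add,
      Multiset.toFinsupp_singleton, X, monomial_mul, one_mul]

lemma dragonFunctional_prod (M : Matroid α) (d : ℕ) (s : Multiset (NonemptyFlat M)) :
    dragonFunctional M d (s.map X).prod =
      if s.card = d then dragonIndicator M (s.map Subtype.val) else 0 := by
  have hcard : (Multiset.toFinsupp s).degree = s.card := by
    conv_rhs => rw [← Multiset.toFinsupp_toMultiset s, Finsupp.card_toMultiset]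
    rfl
  rw [prod_map_X_eq_monomial, dragonFunctional_monomial, hcard, Multiset.toFinsupp_toMultiset]

lemma dragonFunctional_eq_zero_of_isHomogeneous (M : Matroid α) {d k : ℕ} (hk : k ≠ d)
    {p : MvPolynomial (NonemptyFlat M) ℝ} (hp : p.IsHomogeneous k) :
    dragonFunctional M d p = 0 := by
  rw [p.as_sum, map_sum]
  refine Finset.sum_eq_zero fun m hm => ?_
  have hdeg : m.degree = k := by
    have := hp (mem_support_iff.1 hm)
    rwa [Finsupp.degree_eq_weight_one]
  rw [← mul_one (coeff m p), ← smul_eq_mul, ← smul_monomial, map_smul,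
    dragonFunctional_monomial, if_neg (hdeg.trans_ne hk), smul_zero]

/-! ### Ranks as natural numbers -/

/-- The rank of a set in a matroid on a finite type, as a natural number. -/
def rk (M : Matroid α) (X : Set α) : ℕ := (M.eRk X).toNat

lemma rk_closure_union (M : Matroid α) (X Y : Set α) :
    rk M (M.closure X ∪ Y) = rk M (X ∪ Y) := by
  rw [rk, Matroid.eRk_union_closure_left_eq, rk]

lemma isFlat_inter {M : Matroid α} {F G : Set α} (hF : M.IsFlat F) (hG : M.IsFlat G) :
    M.IsFlat (F ∩ G) := by
  rw [Set.inter_eq_iInter]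
  exact Matroid.IsFlat.iInter fun b => by cases b <;> assumption

lemma rk_ground {M : Matroid α} {d : ℕ} (hM : M.eRank = (d : ℕ∞) + 1) : rk M M.E = d + 1 := by
  rw [rk, Matroid.eRk_ground, hM]
  rfl

variable [Fintype α]

lemma cast_rk (M : Matroid α) (X : Set α) : (rk M X : ℕ∞) = M.eRk X :=
  ENat.natCast_toNat (Matroid.eRk_ne_top_iff.2 (M.isRkFinite_of_finite (Set.toFinite X)))

lemma rk_mono (M : Matroid α) {X Y : Set α} (hXY : X ⊆ Y) : rk M X ≤ rk M Y := by
  have := M.eRk_mono hXY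
  simp only [← cast_rk] at this
  exact_mod_cast this

lemma rk_inter_add_rk_union_le (M : Matroid α) (X Y : Set α) :
    rk M (X ∩ Y) + rk M (X ∪ Y) ≤ rk M X + rk M Y := by
  have := M.eRk_inter_add_eRk_union_le X Y
  simp only [← cast_rk] at this
  exact_mod_cast this

lemma eq_of_subset_of_rk_le {M : Matroid α} {F G : Set α} (hF : M.IsFlat F) (hG : M.IsFlat G)
    (hFG : F ⊆ G) (hrk : rk M G ≤ rk M F) : F = G := by
  have := (M.isRkFinite_of_finite (Set.toFinite F)).closure_eq_closure_of_subset_of_eRk_ge_eRk hFG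
    (by simp only [← cast_rk]; exact_mod_cast hrk)
  rwa [hF.closure, hG.closure] at this

lemma rk_lt_of_ssubset {M : Matroid α} {F G : Set α} (hF : M.IsFlat F) (hG : M.IsFlat G)
    (hFG : F ⊂ G) : rk M F < rk M G := by
  by_contra! hle
  exact hFG.ne (eq_of_subset_of_rk_le hF hG hFG.subset hle)

/-! ### The exchange property of the dragon Hall-Rado condition -/

/-- A collection satisfies the dragon Hall-Rado condition if and only if it does so without its
first member `F`, and the sub-collections containing `F` satisfy the required inequality. -/
lemma dragonHallRadoMultiset_cons (M : Matroid α) (F : Set α) (R : Multiset (Set α)) :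
    DragonHallRadoMultiset M (F ::ₘ R) ↔ DragonHallRadoMultiset M R ∧
      ∀ T ≤ R, T.card + 2 ≤ rk M (F ∪ ⋃ S ∈ T, S) := by
  constructor
  · refine fun h => ⟨fun T hT => h T (hT.trans (Multiset.le_cons_self _ _)), fun T hT => ?_⟩
    have := h (F ::ₘ T) (Multiset.cons_le_cons _ hT) (Multiset.cons_ne_zero)
    simp only [Multiset.card_cons, Multiset.mem_cons, Set.iUnion_iUnion_eq_or_left,
      ← cast_rk] at this
    exact_mod_cast this
  · rintro ⟨h₁, h₂⟩ T hT hT0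
    obtain hT | ⟨T, hT', rfl⟩ := le_cons_iff.1 hT
    · exact h₁ T hT hT0
    · have := h₂ T hT'
      simp only [Multiset.card_cons, Multiset.mem_cons, Set.iUnion_iUnion_eq_or_left, ← cast_rk]
      exact_mod_cast this

lemma dragonHallRadoMultiset_cons_cons (M : Matroid α) (F G : Set α) (R : Multiset (Set α)) :
    DragonHallRadoMultiset M (F ::ₘ G ::ₘ R) ↔ DragonHallRadoMultiset M R ∧
      (∀ T ≤ R, T.card + 2 ≤ rk M (F ∪ ⋃ S ∈ T, S)) ∧
      (∀ T ≤ R, T.card + 2 ≤ rk M (G ∪ ⋃ S ∈ T, S)) ∧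
      ∀ T ≤ R, T.card + 3 ≤ rk M (F ∪ G ∪ ⋃ S ∈ T, S) := by
  rw [dragonHallRadoMultiset_cons, dragonHallRadoMultiset_cons]
  constructor
  · rintro ⟨⟨h₁, h₂⟩, h₃⟩
    refine ⟨h₁, fun T hT => h₃ T (hT.trans (Multiset.le_cons_self _ _)), h₂, fun T hT => ?_⟩
    simpa [Set.union_assoc] using h₃ (G ::ₘ T) (Multiset.cons_le_cons _ hT)
  · rintro ⟨h₁, h₂, h₃, h₄⟩
    refine ⟨⟨h₁, h₃⟩, fun T hT => ?_⟩
    obtain hT | ⟨T, hT', rfl⟩ := le_cons_iff.1 hT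
    · exact h₂ T hT
    · simpa [Set.union_assoc] using h₄ T hT'

/-- If a failure of the dragon Hall-Rado inequality involves `F` and another one involves `G`, then
submodularity of the rank yields a failure for their union, involving both `F` and `G`, or for their
intersection, involving neither. -/
lemma forall_le_rk_or_forall_le_rk (M : Matroid α) (F G : Set α) (R : Multiset (Set α))
    (hR : DragonHallRadoMultiset M R)
    (hFG : ∀ T ≤ R, T.card + 3 ≤ rk M (F ∪ G ∪ ⋃ S ∈ T, S)) :
    (∀ T ≤ R, T.card + 2 ≤ rk M (F ∪ ⋃ S ∈ T, S)) ∨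
      ∀ T ≤ R, T.card + 2 ≤ rk M (G ∪ ⋃ S ∈ T, S) := by
  by_contra! hcon
  obtain ⟨⟨S, hS, hFS⟩, T, hT, hGT⟩ := hcon
  have hsub := rk_inter_add_rk_union_le M (F ∪ ⋃ A ∈ S, A) (G ∪ ⋃ A ∈ T, A)
  have hcard : (S ∪ T).card + (S ∩ T).card = S.card + T.card := by
    rw [← Multiset.card_add, Multiset.union_add_inter, Multiset.card_add]
  have hunion := hFG (S ∪ T) (Multiset.union_le hS hT)
  have hle : rk M (F ∪ G ∪ ⋃ A ∈ S ∪ T, A) ≤ rk M ((F ∪ ⋃ A ∈ S, A) ∪ (G ∪ ⋃ A ∈ T, A)) := by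
    apply rk_mono
    intro x
    simp only [Set.mem_union, Set.mem_iUnion, Multiset.mem_union]
    rintro ((h | h) | ⟨A, h | h, hx⟩)
    · exact .inl (.inl h)
    · exact .inr (.inl h)
    · exact .inl (.inr ⟨A, h, hx⟩)
    · exact .inr (.inr ⟨A, h, hx⟩)
  have hinter : (S ∩ T).card ≤ rk M ((F ∪ ⋃ A ∈ S, A) ∩ (G ∪ ⋃ A ∈ T, A)) := by
    by_cases h0 : S ∩ T = 0
    · simp [h0]
    have h₁ := hR (S ∩ T) ((Multiset.inter_le_left).trans hS) h0
    rw [← cast_rk] at h₁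
    have h₂ : (S ∩ T).card + 1 ≤ rk M (⋃ A ∈ S ∩ T, A) := by exact_mod_cast h₁
    refine (Nat.le_succ _).trans (h₂.trans (rk_mono M ?_))
    intro x
    simp only [Set.mem_iUnion, Multiset.mem_inter]
    rintro ⟨A, ⟨h, h'⟩, hx⟩
    exact ⟨.inr (Set.mem_biUnion (t := id) h hx), .inr (Set.mem_biUnion (t := id) h' hx)⟩
  omega

/-- The indicator of the dragon Hall-Rado condition satisfies the relation
`(h_F - h_J) (h_G - h_J) = 0`, in which `J` is the join of `F` and `G`. -/
lemma dragonIndicator_exchange (M : Matroid α) (F G : Set α) (hF : F ⊆ M.E) (hG : G ⊆ M.E)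
    (R : Multiset (Set α)) :
    dragonIndicator M (F ::ₘ G ::ₘ R) +
        dragonIndicator M (M.closure (F ∪ G) ::ₘ M.closure (F ∪ G) ::ₘ R) =
      dragonIndicator M (F ::ₘ M.closure (F ∪ G) ::ₘ R) +
        dragonIndicator M (G ::ₘ M.closure (F ∪ G) ::ₘ R) := by
  have hsub : F ∪ G ⊆ M.closure (F ∪ G) := M.subset_closure _ (Set.union_subset hF hG)
  have hFJ : F ∪ M.closure (F ∪ G) = M.closure (F ∪ G) :=
    Set.union_eq_self_of_subset_left (Set.subset_union_left.trans hsub)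
  have hGJ : G ∪ M.closure (F ∪ G) = M.closure (F ∪ G) :=
    Set.union_eq_self_of_subset_left (Set.subset_union_right.trans hsub)
  simp only [dragonIndicator, dragonHallRadoMultiset_cons_cons, hFJ, hGJ, Set.union_self,
    rk_closure_union]
  have key := forall_le_rk_or_forall_le_rk M F G R
  have hJ : (∀ T ≤ R, T.card + 3 ≤ rk M (F ∪ G ∪ ⋃ S ∈ T, S)) →
      ∀ T ≤ R, T.card + 2 ≤ rk M (F ∪ G ∪ ⋃ S ∈ T, S) :=
    fun h T hT => (Nat.le_succ _).trans (h T hT)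
  generalize DragonHallRadoMultiset M R = P at *
  generalize (∀ T ≤ R, T.card + 2 ≤ rk M (F ∪ ⋃ S ∈ T, S)) = a at *
  generalize (∀ T ≤ R, T.card + 2 ≤ rk M (G ∪ ⋃ S ∈ T, S)) = b at *
  generalize (∀ T ≤ R, T.card + 2 ≤ rk M (F ∪ G ∪ ⋃ S ∈ T, S)) = c at *
  generalize (∀ T ≤ R, T.card + 3 ≤ rk M (F ∪ G ∪ ⋃ S ∈ T, S)) = e at *
  by_cases hP : P <;> by_cases he : e <;> by_cases ha : a <;> by_cases hb : b <;>
    simp_all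

/-- A set of rank one violates the dragon Hall-Rado condition by itself. -/
lemma dragonIndicator_cons_eq_zero (M : Matroid α) {F : Set α} (hF : M.eRk F = 1)
    (R : Multiset (Set α)) : dragonIndicator M (F ::ₘ R) = 0 := by
  rw [dragonIndicator, if_neg]
  rw [dragonHallRadoMultiset_cons]
  rintro ⟨-, h⟩
  have := h 0 (Multiset.zero_le _)
  have h1 : rk M F = 1 := by rw [rk, hF]; rfl
  simp [h1] at this

/-! ### Relations in the Chow ring -/

/-- The image `-∑_{G ⊇ F} z_G` in the Chow ring of the simplicial generator `h_F`. -/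
def hFY (M : Matroid α) (F : NonemptyFlat M) : ChowFY M :=
  -∑ G : NonemptyFlat M with F ≤ G, z M G

lemma z_mul_z_eq_zero {M : Matroid α} {F G : NonemptyFlat M} (hFG : ¬ F ≤ G) (hGF : ¬ G ≤ F) :
    z M F * z M G = 0 := by
  rw [z, z, ← map_mul, Ideal.Quotient.eq_zero_iff_mem]
  exact Ideal.mem_sup_left (Ideal.subset_span ⟨F, G, hFG, hGF, rfl⟩)

lemma sum_z_mem_eq_zero (M : Matroid α) [M.Loopless] {e : α} (he : e ∈ M.E) :
    ∑ F : NonemptyFlat M with e ∈ F.1, z M F = 0 := by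
  have hmem : e ∈ M.closure {e} := M.mem_closure_self e
  have hle (F : NonemptyFlat M) : M.closure {e} ⊆ F.1 ↔ e ∈ F.1 := by
    refine ⟨fun h => h hmem, fun h => ?_⟩
    have := M.closure_subset_closure (Set.singleton_subset_iff.2 h)
    rwa [F.2.1.closure] at this
  have := Ideal.Quotient.eq_zero_iff_mem.2 (Ideal.mem_sup_right (Ideal.subset_span
    ⟨⟨M.closure {e}, M.isFlat_closure _, e, hmem⟩, by
      simpa using Matroid.eRk_singleton_eq he, rfl⟩) :
    ∑ F : NonemptyFlat M with (⟨M.closure {e}, M.isFlat_closure _, e, hmem⟩ : NonemptyFlat M) ≤ F,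
      X F ∈ chowIdeal M)
  rw [map_sum] at this
  refine Eq.trans ?_ this
  exact Finset.sum_congr (Finset.filter_congr fun F _ => (hle F).symm) fun F _ => rfl

/-- Every element `e` of `G` gives an expression of `h_G` in terms of flats not containing `G`. -/
lemma hFY_eq_sum {M : Matroid α} [M.Loopless] {G : NonemptyFlat M} {e : α} (he : e ∈ G.1) :
    hFY M G = ∑ B : NonemptyFlat M with e ∈ B.1 ∧ ¬ G ≤ B, z M B := by
  have h := sum_z_mem_eq_zero M (G.2.1.subset_ground he)
  rw [← Finset.sum_filter_add_sum_filter_not _ (fun B => G ≤ B), Finset.filter_filter,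
    Finset.filter_filter] at h
  rw [hFY, ← neg_eq_of_add_eq_zero_right h]
  congr 2
  ext B
  simp only [Finset.mem_filter, Finset.mem_univ, true_and, iff_and_self]
  exact fun hGB => hGB he

/-- A flat `A` not containing `G` satisfies `z_A h_G ^ m = 0` as soon as `m` is at least
`rk G - rk (A ∩ G)`: multiplication by `h_G` replaces `A` by larger flats `B` for which `B ∩ G` has
larger rank and is still different from `G`. -/
lemma z_mul_hFY_pow_eq_zero {M : Matroid α} [M.Loopless] {G : NonemptyFlat M} (m : ℕ)
    {A : NonemptyFlat M} (hGA : ¬ G ≤ A) (hm : rk M G.1 ≤ m + rk M (A.1 ∩ G.1)) :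
    z M A * hFY M G ^ m = 0 := by
  induction m generalizing A with
  | zero =>
    refine absurd ?_ hGA
    have := eq_of_subset_of_rk_le (isFlat_inter A.2.1 G.2.1) G.2.1 Set.inter_subset_right
      (by simpa using hm)
    exact Set.inter_eq_right.1 this
  | succ m ih =>
    obtain ⟨e, heG, heA⟩ := Set.not_subset.1 hGA
    rw [pow_succ', ← mul_assoc,
      show z M A * hFY M G = ∑ B : NonemptyFlat M with e ∈ B.1 ∧ ¬ G ≤ B, z M A * z M B by
        rw [hFY_eq_sum heG, Finset.mul_sum], Finset.sum_mul]
    refine Finset.sum_eq_zero fun B hB => ?_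
    obtain ⟨heB, hGB⟩ := (Finset.mem_filter.1 hB).2
    by_cases hAB : A ≤ B
    · rw [mul_assoc, ih hGB, mul_zero]
      have : rk M (A.1 ∩ G.1) < rk M (B.1 ∩ G.1) :=
        rk_lt_of_ssubset (isFlat_inter A.2.1 G.2.1) (isFlat_inter B.2.1 G.2.1)
          ⟨Set.inter_subset_inter_left _ hAB, fun h => heA (h ⟨heB, heG⟩).1⟩
      omega
    · rw [z_mul_z_eq_zero hAB fun h => heA (h heB), zero_mul]

lemma hFY_mul_hFY_pow {M : Matroid α} [M.Loopless] {F G : NonemptyFlat M} (hFG : F ≤ G) {m : ℕ}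
    (hm : rk M G.1 ≤ m + rk M F.1) : hFY M F * hFY M G ^ m = hFY M G ^ (m + 1) := by
  have hsub : hFY M F = hFY M G - ∑ A : NonemptyFlat M with F ≤ A ∧ ¬ G ≤ A, z M A := by
    rw [hFY, hFY, ← Finset.sum_filter_add_sum_filter_not _ (fun B => G ≤ B), Finset.filter_filter,
      Finset.filter_filter, neg_add, sub_eq_add_neg]
    congr 3
    ext B
    simp only [Finset.mem_filter, Finset.mem_univ, true_and, and_iff_right_iff_imp]
    exact hFG.trans
  rw [hsub, sub_mul, ← pow_succ', sub_eq_self, Finset.sum_mul]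
  refine Finset.sum_eq_zero fun A hA => ?_
  obtain ⟨hFA, hGA⟩ := (Finset.mem_filter.1 hA).2
  refine z_mul_hFY_pow_eq_zero m hGA (hm.trans ?_)
  gcongr
  exact rk_mono M (Set.subset_inter hFA hFG)

lemma rk_pos {M : Matroid α} [M.Loopless] {X : Set α} (hX : X ⊆ M.E) (hX' : X.Nonempty) :
    1 ≤ rk M X := by
  obtain ⟨e, he⟩ := hX'
  have := rk_mono M (Set.singleton_subset_iff.2 he)
  rwa [rk, Matroid.eRk_singleton_eq (hX he), ENat.toNat_one] at this

lemma hFY_pow_eq_zero {M : Matroid α} [M.Loopless] {G : NonemptyFlat M} {m : ℕ}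
    (hm : rk M G.1 ≤ m) : hFY M G ^ m = 0 := by
  obtain ⟨e, he⟩ := G.2.2
  obtain ⟨m, rfl⟩ : ∃ k, m = k + 1 :=
    ⟨m - 1, by have := rk_pos G.2.1.subset_ground G.2.2; omega⟩
  rw [pow_succ', hFY_eq_sum he, Finset.sum_mul]
  refine Finset.sum_eq_zero fun B hB => ?_
  obtain ⟨heB, hGB⟩ := (Finset.mem_filter.1 hB).2
  rw [← hFY_eq_sum he]
  refine z_mul_hFY_pow_eq_zero m hGB (hm.trans ?_)
  gcongr
  exact rk_pos (Set.inter_subset_left.trans B.2.1.subset_ground) ⟨e, heB, he⟩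

/-- Expanding `(h_F - h_J) (h_G - h_J)`, where `J` is the join of `F` and `G`, leaves only products
`z_A z_B` of incomparable flats. -/
lemma hFY_mul_hFY {M : Matroid α} (F G : NonemptyFlat M) :
    hFY M F * hFY M G = hFY M F * hFY M (join F G) + hFY M G * hFY M (join F G)
      - hFY M (join F G) * hFY M (join F G) := by
  have hsub (F G : NonemptyFlat M) : hFY M (join F G) - hFY M F
      = ∑ A : NonemptyFlat M with F ≤ A ∧ ¬ G ≤ A, z M A := by
    rw [hFY, hFY, ← Finset.sum_filter_add_sum_filter_not ({A | F ≤ A}) (fun B => G ≤ B),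
      Finset.filter_filter, Finset.filter_filter]
    simp only [join_le_iff]
    ring
  have hcomm : join G F = join F G := Subtype.ext (by simp [join, Set.union_comm])
  have key : (hFY M (join F G) - hFY M F) * (hFY M (join F G) - hFY M G) = 0 := by
    rw [hsub F G, ← hcomm, hsub G F, Finset.sum_mul_sum]
    refine Finset.sum_eq_zero fun A hA => Finset.sum_eq_zero fun B hB => ?_
    simp only [Finset.mem_filter, Finset.mem_univ, true_and] at hA hB
    exact z_mul_z_eq_zero (fun h => hB.2 (hA.1.trans h)) fun h => hA.2 (hB.1.trans h)
  linear_combination key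

/-! ### The top degree is spanned by one element -/

/-- The product of the simplicial generators of a chain of flats contained in `G`, multiplied by a
power of `h_G`, is a multiple of a power of `h_G`, as soon as the total degree is at least
`rk G - 1`. Let `F` be the largest member of the chain. Either the power of `h_G` is high enough
to turn the factor `h_F` into `h_G`, or the chain has at least `rk F` members, and its product is a
multiple of `h_F ^ rk F = 0`. -/
lemma exists_prod_hFY_mul_pow_eq_smul {M : Matroid α} [M.Loopless] (n : ℕ)
    (s : Multiset (NonemptyFlat M)) (hn : s.card = n) (hs : ∀ F ∈ s, ∀ G ∈ s, F ≤ G ∨ G ≤ F)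
    (G : NonemptyFlat M) (hG : ∀ F ∈ s, F ≤ G) (m : ℕ) (hm : rk M G.1 ≤ m + n + 1) :
    ∃ c : ℝ, (s.map (hFY M)).prod * hFY M G ^ m = c • hFY M G ^ (m + n) := by
  induction n generalizing s G m with
  | zero =>
    obtain rfl := Multiset.card_eq_zero.1 hn
    exact ⟨1, by simp⟩
  | succ n ih =>
    obtain ⟨F, hF, hmax⟩ : ∃ F ∈ s, ∀ F' ∈ s, F' ≤ F := by
      have hne : s.toFinset.Nonempty := by
        rw [Multiset.toFinset_nonempty]
        rintro rfl
        simp at hn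
      obtain ⟨F, hF⟩ := s.toFinset.exists_maximal hne
      refine ⟨F, Multiset.mem_toFinset.1 hF.1, fun F' hF' => ?_⟩
      exact (hs F' hF' F (Multiset.mem_toFinset.1 hF.1)).elim id
        fun h => hF.2 (Multiset.mem_toFinset.2 hF') h
    obtain ⟨t, rfl⟩ := Multiset.exists_cons_of_mem hF
    have ht : t.card = n := by simpa using hn
    have hts : ∀ F ∈ t, ∀ G ∈ t, F ≤ G ∨ G ≤ F := fun F hF G hG =>
      hs F (Multiset.mem_cons_of_mem hF) G (Multiset.mem_cons_of_mem hG)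
    by_cases hFm : rk M G.1 ≤ m + rk M F.1
    · obtain ⟨c, hc⟩ := ih t ht hts G (fun F hF => hG F (Multiset.mem_cons_of_mem hF)) (m + 1)
        (by omega)
      refine ⟨c, ?_⟩
      rw [Multiset.map_cons, Multiset.prod_cons, mul_comm (hFY M F), mul_assoc,
        hFY_mul_hFY_pow (hG F hF) hFm, hc]
      congr 2
      omega
    · obtain ⟨c, hc⟩ := ih t ht hts F (fun F' hF' => hmax F' (Multiset.mem_cons_of_mem hF')) 1
        (by omega)
      refine ⟨0, ?_⟩
      rw [Multiset.map_cons, Multiset.prod_cons, mul_comm (hFY M F), ← pow_one (hFY M F), hc,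
        hFY_pow_eq_zero (by omega), smul_zero, zero_mul, zero_smul]

/-- The ground set of a matroid of positive rank, as a nonempty flat. -/
def groundFlat {M : Matroid α} {d : ℕ} (hM : M.eRank = (d : ℕ∞) + 1) : NonemptyFlat M :=
  ⟨M.E, M.ground_isFlat, by
    rw [Set.nonempty_iff_ne_empty]
    intro h0
    rw [Matroid.eRank_def, h0, Matroid.eRk_empty] at hM
    exact absurd hM.symm (by simp)⟩

lemma rk_le {M : Matroid α} {d : ℕ} (hM : M.eRank = (d : ℕ∞) + 1) (F : NonemptyFlat M) :
    rk M F.1 ≤ d + 1 :=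
  (rk_mono M F.2.1.subset_ground).trans (rk_ground hM).le

/-- Every product of `d` simplicial generators is a multiple of `h_E ^ d`: the relation
`h_F h_G = h_F h_J + h_G h_J - h_J ^ 2`, with `J` the join of `F` and `G`, reduces the claim to
chains of flats. -/
lemma exists_prod_hFY_eq_smul {M : Matroid α} [M.Loopless] {d : ℕ}
    (hM : M.eRank = (d : ℕ∞) + 1) (s : Multiset (NonemptyFlat M)) (hs : s.card = d) :
    ∃ c : ℝ, (s.map (hFY M)).prod = c • hFY M (groundFlat hM) ^ d := by
  -- The total corank decreases when flats are replaced by larger ones.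
  induction hn : (s.map fun F => d + 1 - rk M F.1).sum using Nat.strong_induction_on
    generalizing s with
  | _ n ih =>
    by_cases hchain : ∀ F ∈ s, ∀ G ∈ s, F ≤ G ∨ G ≤ F
    · have := exists_prod_hFY_mul_pow_eq_smul d s hs hchain (groundFlat hM)
        (fun F _ => F.2.1.subset_ground) 0 (by simp [groundFlat, rk_ground hM])
      simpa using this
    · push Not at hchain
      obtain ⟨F, hF, G, hG, hFG, hGF⟩ := hchain
      obtain ⟨t, rfl⟩ := Multiset.exists_cons_of_mem hF
      have hGt : G ∈ t := (Multiset.mem_cons.1 hG).resolve_left fun h => hFG h.ge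
      obtain ⟨t, rfl⟩ := Multiset.exists_cons_of_mem hGt
      obtain ⟨hFJ, hGJ⟩ := join_le_iff.1 (le_refl (join F G))
      have h₁ : rk M F.1 < rk M (join F G).1 :=
        rk_lt_of_ssubset F.2.1 (join F G).2.1 ⟨hFJ, fun h => hGF (hGJ.trans h)⟩
      have h₂ : rk M G.1 < rk M (join F G).1 :=
        rk_lt_of_ssubset G.2.1 (join F G).2.1 ⟨hGJ, fun h => hFG (hFJ.trans h)⟩
      have h₃ := rk_le hM (join F G)
      simp only [Multiset.map_cons, Multiset.sum_cons] at hn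
      simp only [Multiset.card_cons] at hs
      obtain ⟨a, ha⟩ := ih _ (by
        simp only [Multiset.map_cons, Multiset.sum_cons]; omega)
        (F ::ₘ join F G ::ₘ t) (by simpa) rfl
      obtain ⟨b, hb⟩ := ih _ (by
        simp only [Multiset.map_cons, Multiset.sum_cons]; omega)
        (G ::ₘ join F G ::ₘ t) (by simpa) rfl
      obtain ⟨c, hc⟩ := ih _ (by
        simp only [Multiset.map_cons, Multiset.sum_cons]; omega)
        (join F G ::ₘ join F G ::ₘ t) (by simpa) rfl
      refine ⟨a + b - c, ?_⟩
      rw [sub_smul, add_smul, ← ha, ← hb, ← hc]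
      simp only [Multiset.map_cons, Multiset.prod_cons]
      linear_combination (t.map (hFY M)).prod * hFY_mul_hFY F G

/-! ### Maximal chains of flats -/

/-- The members of a maximal chain of nonempty proper flats have ranks `1, …, d`. -/
lemma rk_of_strictMono {M : Matroid α} [M.Loopless] {d : ℕ} (hM : M.eRank = (d : ℕ∞) + 1)
    {F : Fin d → NonemptyFlat M} (hF : StrictMono F) (hFE : ∀ i, (F i).1 ≠ M.E) (i : Fin d) :
    rk M (F i).1 = i + 1 := by
  have hlt {i j : Fin d} (hij : i < j) : rk M (F i).1 < rk M (F j).1 :=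
    rk_lt_of_ssubset (F i).2.1 (F j).2.1 (hF hij)
  have hlow (k : ℕ) (hk : k < d) : k + 1 ≤ rk M (F ⟨k, hk⟩).1 := by
    induction k with
    | zero => exact rk_pos (F _).2.1.subset_ground (F _).2.2
    | succ k ih =>
      exact (Nat.succ_le_succ (ih (by omega))).trans (hlt (Fin.mk_lt_mk.2 k.lt_succ_self))
  have hup (k : ℕ) (hk : k < d) : rk M (F ⟨d - 1 - k, by omega⟩).1 + k ≤ d := by
    induction k with
    | zero =>
      have := rk_lt_of_ssubset (F ⟨d - 1 - 0, by omega⟩).2.1 M.ground_isFlat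
        ((F ⟨d - 1 - 0, by omega⟩).2.1.subset_ground.ssubset_of_ne (hFE _))
      rw [rk_ground hM] at this
      omega
    | succ k ih =>
      have h₁ := ih (by omega)
      have h₂ := hlt (i := ⟨d - 1 - (k + 1), by omega⟩) (j := ⟨d - 1 - k, by omega⟩)
        (Fin.mk_lt_mk.2 (by omega))
      omega
  have h₁ : i.1 + 1 ≤ rk M (F i).1 := hlow i i.2
  have h₂ := hup (d - 1 - i) (by omega)
  have h₃ : (⟨d - 1 - (d - 1 - i), by omega⟩ : Fin d) = i := Fin.ext (by simp; omega)
  rw [h₃] at h₂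
  omega

/-- The product of a maximal chain of nonempty proper flats is `h_E ^ d`. The factors `h_E` are
replaced one at a time by the flats of the chain: if `e` is an element of the next flat `F_k` of the
chain but not of the previous one, then `h_E` is the sum of `z_B` over the proper flats
`B` containing `e`, and only the term `B = F_k` survives. -/
lemma prod_z_eq_hFY_pow {M : Matroid α} [M.Loopless] {d : ℕ} (hM : M.eRank = (d : ℕ∞) + 1)
    {F : Fin d → NonemptyFlat M} (hF : StrictMono F) (hFE : ∀ i, (F i).1 ≠ M.E) :
    ∏ i, z M (F i) = hFY M (groundFlat hM) ^ d := by
  have hrk := rk_of_strictMono hM hF hFE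
  have key (k : ℕ) (hk : k ≤ d) : (∏ i : Fin d with i.1 < k, z M (F i)) *
      hFY M (groundFlat hM) ^ (d - k) = hFY M (groundFlat hM) ^ d := by
    induction k with
    | zero => simp
    | succ k ih =>
      rw [← ih (by omega)]
      set i₀ : Fin d := ⟨k, hk⟩ with hi₀
      obtain ⟨e, he, hlt⟩ : ∃ e ∈ (F i₀).1, ∀ i : Fin d, i.1 < k → e ∉ (F i).1 := by
        by_cases hk0 : k = 0
        · obtain ⟨e, he⟩ := (F i₀).2.2
          exact ⟨e, he, fun i hi => by omega⟩
        · have hlt : (⟨k - 1, by omega⟩ : Fin d) < i₀ := Fin.mk_lt_mk.2 (by omega)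
          obtain ⟨e, he, he'⟩ := Set.not_subset.1 (hF hlt).not_ge
          refine ⟨e, he, fun i hi h => he' ?_⟩
          exact hF.monotone (show i ≤ ⟨k - 1, by omega⟩ from Fin.mk_le_mk.2 (by omega)) h
      have hsplit : (∏ i : Fin d with i.1 < k + 1, z M (F i)) =
          (∏ i : Fin d with i.1 < k, z M (F i)) * z M (F i₀) := by
        rw [mul_comm, ← Finset.prod_insert (f := fun i => z M (F i)) (by simp [hi₀])]
        congr 1
        ext i
        simp only [Finset.mem_filter, Finset.mem_univ, true_and, Finset.mem_insert, Fin.ext_iff,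
          hi₀]
        omega
      have hE : hFY M (groundFlat hM) =
          ∑ B : NonemptyFlat M with e ∈ B.1 ∧ ¬ groundFlat hM ≤ B, z M B :=
        hFY_eq_sum ((F i₀).2.1.subset_ground he)
      have hd : d - k = d - (k + 1) + 1 := by omega
      rw [hsplit, hd, pow_succ', ← mul_assoc _ (hFY M _), mul_assoc _ (z M _),
        mul_assoc _ (hFY M _)]
      rw [show hFY M (groundFlat hM) * hFY M (groundFlat hM) ^ (d - (k + 1)) =
        ∑ B : NonemptyFlat M with e ∈ B.1 ∧ ¬ groundFlat hM ≤ B,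
          z M B * hFY M (groundFlat hM) ^ (d - (k + 1)) by
        rw [← Finset.sum_mul, ← hE], Finset.mul_sum]
      symm
      apply Finset.sum_eq_single
      · intro B hB hBne
        obtain ⟨heB, hEB⟩ := (Finset.mem_filter.1 hB).2
        by_cases hrB : k + 2 ≤ rk M B.1
        · rw [z_mul_hFY_pow_eq_zero _ hEB, mul_zero]
          have : B.1 ∩ (groundFlat hM).1 = B.1 := Set.inter_eq_left.2 B.2.1.subset_ground
          rw [this, show rk M (groundFlat hM).1 = d + 1 from rk_ground hM]
          omega
        · by_cases hcomp : ∃ i : Fin d, i.1 < k ∧ ¬ F i ≤ B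
          · obtain ⟨i, hi, hiB⟩ := hcomp
            have h0 : z M (F i) * z M B = 0 := z_mul_z_eq_zero hiB fun h => hlt i hi (h heB)
            rw [← Finset.mul_prod_erase _ _ (Finset.mem_filter.2 ⟨Finset.mem_univ i, hi⟩)]
            linear_combination (∏ x ∈ ({i | i.1 < k} : Finset (Fin d)).erase i, z M (F x)) *
              hFY M (groundFlat hM) ^ (d - (k + 1)) * h0
          · push Not at hcomp
            exfalso
            -- `B ∩ F_k` is a flat of rank at least `k + 1`, hence equal to both `B` and `F_k`.
            have hk1 : k + 1 ≤ rk M (B.1 ∩ (F i₀).1) := by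
              by_cases hk0 : k = 0
              · subst hk0
                exact rk_pos (Set.inter_subset_left.trans B.2.1.subset_ground) ⟨e, heB, he⟩
              · have hlt' : (⟨k - 1, by omega⟩ : Fin d) < i₀ := Fin.mk_lt_mk.2 (by omega)
                have h₁ := rk_lt_of_ssubset (F ⟨k - 1, by omega⟩).2.1
                  (isFlat_inter B.2.1 (F i₀).2.1)
                  ⟨Set.subset_inter (hcomp ⟨k - 1, by omega⟩ (by simp; omega)) (hF hlt').le,
                    fun h => hlt ⟨k - 1, by omega⟩ (by simp; omega) (h ⟨heB, he⟩)⟩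
                rw [hrk] at h₁
                simp only at h₁
                omega
            have h₁ := eq_of_subset_of_rk_le (isFlat_inter B.2.1 (F i₀).2.1) B.2.1
              Set.inter_subset_left (by omega)
            have h₂ := eq_of_subset_of_rk_le (isFlat_inter B.2.1 (F i₀).2.1) (F i₀).2.1
              Set.inter_subset_right (by rw [hrk]; exact hk1)
            exact hBne (Subtype.ext (h₁.symm.trans h₂))
      · intro h
        refine absurd (Finset.mem_filter.2 ⟨Finset.mem_univ _, he, fun h => hFE i₀ ?_⟩) h
        exact (F i₀).2.1.subset_ground.antisymm h
  simpa using key d le_rfl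

/-- A maximal chain of nonempty proper flats exists: the closures of the initial segments of a
base. -/
lemma exists_strictMono_flat {M : Matroid α} {d : ℕ} (hM : M.eRank = (d : ℕ∞) + 1) :
    ∃ F : Fin d → NonemptyFlat M, StrictMono F ∧ ∀ i, (F i).1 ≠ M.E := by
  obtain ⟨B, hB⟩ := M.exists_isBase
  have hcard : Fintype.card B = d + 1 := by
    have := hB.encard_eq_eRank
    rw [hM, ← Set.coe_fintypeCard] at this
    exact_mod_cast this
  let e : Fin (d + 1) ≃ B := (Fintype.equivFinOfCardEq hcard).symm
  let S (i : Fin d) : Set α := (fun j => (e j : α)) '' Set.Iic i.castSucc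
  have hinj : Function.Injective fun j => (e j : α) := Subtype.val_injective.comp e.injective
  have hSB (i : Fin d) : S i ⊆ B := by
    rintro _ ⟨j, -, rfl⟩
    exact (e j).2
  have hnotMem {i : Fin d} {j : Fin (d + 1)} (hj : i.castSucc < j) :
      (e j : α) ∉ M.closure (S i) := by
    have := (Matroid.indep_iff_forall_notMem_closure_sdiff hB.subset_ground).1 hB.indep (e j).2
    refine fun h => this (M.closure_subset_closure ?_ h)
    refine fun x hx => ⟨hSB i hx, ?_⟩
    rintro rfl
    obtain ⟨k, hk, hkj⟩ := hx
    exact absurd (hinj hkj ▸ hk : j ∈ Set.Iic i.castSucc) (not_le.2 hj)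
  have hmem {i : Fin d} {j : Fin (d + 1)} (hj : j ≤ i.castSucc) : (e j : α) ∈ M.closure (S i) :=
    M.mem_closure_of_mem ⟨j, hj, rfl⟩ ((hSB i).trans hB.subset_ground)
  refine ⟨fun i => ⟨M.closure (S i), M.isFlat_closure _, e i.castSucc, hmem le_rfl⟩, ?_, ?_⟩
  · intro i j hij
    refine lt_of_le_not_ge (M.closure_subset_closure (Set.image_mono
      (Set.Iic_subset_Iic.2 (Fin.castSucc_le_castSucc_iff.2 hij.le)))) fun h => ?_
    exact hnotMem (Fin.castSucc_lt_castSucc_iff.2 hij) (h (hmem le_rfl))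
  · intro i h
    exact hnotMem (Fin.castSucc_lt_last i) (h.ge (hB.subset_ground (e _).2))

/-! ### Inversion of sums over upper sets -/

lemma exists_eq_neg_sum {β V : Type*} [Fintype β] [PartialOrder β] [AddCommGroup V] (f : β → V) :
    ∃ g : β → V, ∀ b, f b = -∑ c with b ≤ c, g c := by
  let g : β → V := (wellFounded_gt (α := β)).fix fun b g => -f b - ∑ c : {c // b < c}, g c.1 c.2
  refine ⟨g, fun b => ?_⟩
  have hg : g b = -f b - ∑ c : {c // b < c}, g c.1 := WellFounded.fix_eq _ _ b
  have hset : ({c | b ≤ c} : Finset β) = insert b ({c | b < c} : Finset β) := by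
    ext c
    simp [le_iff_eq_or_lt, eq_comm]
  rw [hset, Finset.sum_insert (by simp), hg,
    Finset.sum_subtype (p := fun c => b < c) ({c | b < c} : Finset β) (by simp) g]
  abel

lemma eq_of_sum_eq_sum {β V : Type*} [Fintype β] [PartialOrder β] [AddCommGroup V] {f g : β → V}
    (h : ∀ b, ∑ c with b ≤ c, f c = ∑ c with b ≤ c, g c) : f = g := by
  funext b
  induction b using (wellFounded_gt (α := β)).induction with
  | _ b ih =>
    have hset : ({c | b ≤ c} : Finset β) = insert b ({c | b < c} : Finset β) := by
      ext c
      simp [le_iff_eq_or_lt, eq_comm]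
    have := h b
    rw [hset, Finset.sum_insert (by simp), Finset.sum_insert (by simp),
      Finset.sum_congr rfl fun c hc => ih c (Finset.mem_filter.1 hc).2] at this
    exact add_right_cancel this

/-- The linear forms in the variables `h_F` which express the generators `z_F`: they are determined
by `h_F = -∑_{G ⊇ F} z_G`. -/
def zForm (M : Matroid α) : NonemptyFlat M → homogeneousSubmodule (NonemptyFlat M) ℝ 1 :=
  Classical.choose (exists_eq_neg_sum fun F => ⟨X F, isHomogeneous_X ℝ F⟩)

lemma X_eq_neg_sum_zForm (M : Matroid α) (F : NonemptyFlat M) :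
    (X F : MvPolynomial (NonemptyFlat M) ℝ) = -∑ G with F ≤ G, (zForm M G).1 := by
  have := congrArg Subtype.val (Classical.choose_spec
    (exists_eq_neg_sum fun F : NonemptyFlat M =>
      (⟨X F, isHomogeneous_X ℝ F⟩ : homogeneousSubmodule (NonemptyFlat M) ℝ 1)) F)
  simpa [zForm] using this

/-- The change of variables from `z` to `h`. -/
def toSimplicial (M : Matroid α) :
    MvPolynomial (NonemptyFlat M) ℝ →ₐ[ℝ] MvPolynomial (NonemptyFlat M) ℝ :=
  aeval fun F => (zForm M F).1

/-- The change of variables from `h` to `z`. -/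
def ofSimplicial (M : Matroid α) :
    MvPolynomial (NonemptyFlat M) ℝ →ₐ[ℝ] MvPolynomial (NonemptyFlat M) ℝ :=
  aeval fun F => -∑ G with F ≤ G, X G

lemma toSimplicial_ofSimplicial (M : Matroid α) (p : MvPolynomial (NonemptyFlat M) ℝ) :
    toSimplicial M (ofSimplicial M p) = p := by
  have : (toSimplicial M).comp (ofSimplicial M) = AlgHom.id ℝ _ := by
    refine algHom_ext fun F => ?_
    simp [toSimplicial, ofSimplicial, ← X_eq_neg_sum_zForm]
  exact DFunLike.congr_fun this p

lemma simplicialHom_X (M : Matroid α) (F : NonemptyFlat M) : simplicialHom M (X F) = hFY M F := by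
  simp [simplicialHom, hFY]

lemma mk_ofSimplicial (M : Matroid α) (p : MvPolynomial (NonemptyFlat M) ℝ) :
    Ideal.Quotient.mkₐ ℝ (chowIdeal M) (ofSimplicial M p) = simplicialHom M p := by
  have : (Ideal.Quotient.mkₐ ℝ (chowIdeal M)).comp (ofSimplicial M) = simplicialHom M := by
    refine algHom_ext fun F => ?_
    rw [simplicialHom_X, AlgHom.comp_apply, ofSimplicial, aeval_X, map_neg, map_sum]
    rfl
  exact DFunLike.congr_fun this p

lemma simplicialHom_toSimplicial (M : Matroid α) (p : MvPolynomial (NonemptyFlat M) ℝ) :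
    simplicialHom M (toSimplicial M p) = Ideal.Quotient.mkₐ ℝ (chowIdeal M) p := by
  have hz : (fun F => simplicialHom M (zForm M F).1) = z M := by
    refine eq_of_sum_eq_sum fun F => ?_
    rw [← map_sum, ← neg_inj, ← map_neg, ← X_eq_neg_sum_zForm, simplicialHom_X, hFY]
  have : (simplicialHom M).comp (toSimplicial M) = Ideal.Quotient.mkₐ ℝ (chowIdeal M) := by
    refine algHom_ext fun F => ?_
    rw [AlgHom.comp_apply, toSimplicial, aeval_X]
    exact congrFun hz F
  exact DFunLike.congr_fun this p

lemma isHomogeneous_toSimplicial {M : Matroid α} {p : MvPolynomial (NonemptyFlat M) ℝ} {k : ℕ}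
    (hp : p.IsHomogeneous k) : (toSimplicial M p).IsHomogeneous k := by
  have := hp.aeval (fun F => (zForm M F).1) fun F => (zForm M F).2
  rwa [one_mul] at this

lemma isHomogeneous_ofSimplicial {M : Matroid α} {p : MvPolynomial (NonemptyFlat M) ℝ} {k : ℕ}
    (hp : p.IsHomogeneous k) : (ofSimplicial M p).IsHomogeneous k := by
  have := hp.aeval (fun F : NonemptyFlat M => -∑ G with F ≤ G, X G) fun F =>
    (IsHomogeneous.sum _ _ _ fun G _ => isHomogeneous_X ℝ G).neg
  rwa [one_mul] at this

/-! ### Descent of the functional to the Chow ring -/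

/-- Linear maps on a polynomial ring are determined by their values on products of variables. -/
lemma eq_of_prod_map_X {σ V : Type*} [AddCommGroup V] [Module ℝ V]
    {f g : MvPolynomial σ ℝ →ₗ[ℝ] V} (h : ∀ s : Multiset σ, f (s.map X).prod = g (s.map X).prod) :
    f = g := by
  refine (basisMonomials σ ℝ).ext fun m => ?_
  rw [coe_basisMonomials]
  have := h m.toMultiset
  rwa [prod_map_X_eq_monomial, Finsupp.toMultiset_toFinsupp] at this

lemma dragonFunctional_X_mul_eq_zero (M : Matroid α) (d : ℕ) {a : NonemptyFlat M}
    (ha : M.eRk a.1 = 1) (q : MvPolynomial (NonemptyFlat M) ℝ) :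
    dragonFunctional M d (X a * q) = 0 := by
  have : dragonFunctional M d ∘ₗ LinearMap.mulLeft ℝ (X a) = 0 := by
    refine eq_of_prod_map_X fun s => ?_
    rw [LinearMap.comp_apply, LinearMap.mulLeft_apply, ← Multiset.prod_cons, ← Multiset.map_cons,
      dragonFunctional_prod, Multiset.map_cons, dragonIndicator_cons_eq_zero M ha]
    simp
  exact DFunLike.congr_fun this q

lemma dragonFunctional_exchange (M : Matroid α) (d : ℕ) (F G : NonemptyFlat M)
    (q : MvPolynomial (NonemptyFlat M) ℝ) :
    dragonFunctional M d ((X (join F G) - X F) * (X (join F G) - X G) * q) = 0 := by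
  have : dragonFunctional M d ∘ₗ LinearMap.mulLeft ℝ ((X (join F G) - X F) * (X (join F G) - X G))
      = 0 := by
    refine eq_of_prod_map_X fun s => ?_
    have hprod (A B : NonemptyFlat M) : (X A * X B * (s.map X).prod : MvPolynomial _ ℝ) =
        ((A ::ₘ B ::ₘ s).map X).prod := by simp [mul_assoc]
    have hexp : ((X (join F G) - X F) * (X (join F G) - X G) * (s.map X).prod : MvPolynomial _ ℝ) =
        X F * X G * (s.map X).prod + X (join F G) * X (join F G) * (s.map X).prod -
          X F * X (join F G) * (s.map X).prod - X G * X (join F G) * (s.map X).prod := by ring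
    rw [LinearMap.comp_apply, LinearMap.mulLeft_apply, hexp, hprod, hprod, hprod, hprod,
      map_sub, map_sub, map_add]
    simp only [dragonFunctional_prod]
    simp only [Multiset.map_cons, Multiset.card_cons]
    have := dragonIndicator_exchange M F.1 G.1 F.2.1.subset_ground G.2.1.subset_ground
      (s.map Subtype.val)
    by_cases hd : s.card + 1 + 1 = d
    · simp only [if_pos hd, join, LinearMap.zero_apply]
      linear_combination this
    · simp [if_neg hd]
  exact DFunLike.congr_fun this q

/-- The functional kills the relation `z_F z_G = 0` for incomparable `F` and `G`. By induction from
larger to smaller pairs of flats, this follows from the relation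
`(h_F - h_J) (h_G - h_J) = 0`, which is a sum of terms `z_A z_B` with incomparable `A ⊇ F` and
`B ⊇ G`. -/
lemma dragonFunctional_zForm_mul_zForm (M : Matroid α) (d : ℕ) (F G : NonemptyFlat M)
    (hFG : ¬ F ≤ G) (hGF : ¬ G ≤ F) (q : MvPolynomial (NonemptyFlat M) ℝ) :
    dragonFunctional M d ((zForm M F).1 * (zForm M G).1 * q) = 0 := by
  induction hP : (F, G) using
    (wellFounded_gt (α := NonemptyFlat M × NonemptyFlat M)).induction generalizing F G with
  | _ P ih =>
    subst hP
    have hsub (F G : NonemptyFlat M) : (X (join F G) - X F : MvPolynomial _ ℝ)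
        = ∑ A : NonemptyFlat M with F ≤ A ∧ ¬ G ≤ A, (zForm M A).1 := by
      rw [X_eq_neg_sum_zForm, X_eq_neg_sum_zForm M F,
        ← Finset.sum_filter_add_sum_filter_not ({A | F ≤ A}) (fun B => G ≤ B),
        Finset.filter_filter, Finset.filter_filter]
      simp only [join_le_iff]
      ring
    have hcomm : join G F = join F G := Subtype.ext (by simp [join, Set.union_comm])
    have h := dragonFunctional_exchange M d F G q
    rw [hsub F G, ← hcomm, hsub G F, Finset.sum_mul_sum, ← Finset.sum_product', Finset.sum_mul,
      map_sum] at h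
    rw [← h]
    symm
    refine Finset.sum_eq_single (F, G) (fun Q hQ hne => ?_) fun hmem => ?_
    · simp only [Finset.mem_product, Finset.mem_filter, Finset.mem_univ, true_and] at hQ
      obtain ⟨⟨hFA, hGA⟩, hGB, hFB⟩ := hQ
      refine ih Q (lt_of_le_of_ne (show (F, G) ≤ Q from ⟨hFA, hGB⟩) hne.symm) Q.1 Q.2
        (fun hle => hFB (hFA.trans hle)) (fun hle => hGA (hGB.trans hle)) rfl
    · exact absurd (by simp [hFG, hGF]) hmem

lemma dragonFunctional_toSimplicial_eq_zero (M : Matroid α) (d : ℕ)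
    {p : MvPolynomial (NonemptyFlat M) ℝ} (hp : p ∈ chowIdeal M) :
    dragonFunctional M d (toSimplicial M p) = 0 := by
  let K : Ideal (MvPolynomial (NonemptyFlat M) ℝ) :=
    { carrier := {p | ∀ q, dragonFunctional M d (toSimplicial M p * q) = 0}
      zero_mem' := fun q => by simp
      add_mem' := fun {a b} ha hb q => by rw [map_add, add_mul, map_add, ha, hb, add_zero]
      smul_mem' := fun c a ha q => by
        rw [smul_eq_mul, map_mul (toSimplicial M), mul_comm (toSimplicial M c), mul_assoc, ha] }
  have hle : chowIdeal M ≤ K := by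
    refine sup_le (Ideal.span_le.2 ?_) (Ideal.span_le.2 ?_)
    · rintro _ ⟨F, G, hFG, hGF, rfl⟩ q
      rw [map_mul (toSimplicial M), toSimplicial, aeval_X, aeval_X]
      exact dragonFunctional_zForm_mul_zForm M d F G hFG hGF q
    · rintro _ ⟨a, ha, rfl⟩ q
      have : toSimplicial M (∑ F : NonemptyFlat M with a ≤ F, X F) = -X a := by
        rw [X_eq_neg_sum_zForm, neg_neg, map_sum]
        exact Finset.sum_congr rfl fun F _ => aeval_X _ _
      rw [this, neg_mul, map_neg, dragonFunctional_X_mul_eq_zero M d ha, neg_zero]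
  simpa using hle hp 1

/-! ### The degree map -/

/-- The dragon functional descends to the Chow ring. -/
lemma exists_descent (M : Matroid α) (d : ℕ) :
    ∃ deg : ChowFY M →ₗ[ℝ] ℝ, ∀ p, deg (Ideal.Quotient.mkₐ ℝ (chowIdeal M) p) =
      dragonFunctional M d (toSimplicial M p) := by
  obtain ⟨σ, hσ⟩ := LinearMap.exists_rightInverse_of_surjective
    (Ideal.Quotient.mkₐ ℝ (chowIdeal M)).toLinearMap
    (LinearMap.range_eq_top.2 (Ideal.Quotient.mkₐ_surjective ℝ (chowIdeal M)))
  refine ⟨dragonFunctional M d ∘ₗ (toSimplicial M).toLinearMap ∘ₗ σ, fun p => ?_⟩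
  have hmem : σ (Ideal.Quotient.mkₐ ℝ (chowIdeal M) p) - p ∈ chowIdeal M :=
    Ideal.Quotient.eq.1 (DFunLike.congr_fun hσ (Ideal.Quotient.mkₐ ℝ (chowIdeal M) p))
  have := dragonFunctional_toSimplicial_eq_zero M d hmem
  rw [map_sub, map_sub, sub_eq_zero] at this
  exact this

lemma simplicialHom_mem_gradedPiece {M : Matroid α} {p : MvPolynomial (NonemptyFlat M) ℝ} {k : ℕ}
    (hp : p.IsHomogeneous k) : simplicialHom M p ∈ gradedPiece M k :=
  ⟨ofSimplicial M p, isHomogeneous_ofSimplicial hp, mk_ofSimplicial M p⟩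

lemma simplicialHom_prod (M : Matroid α) (s : Multiset (NonemptyFlat M)) :
    simplicialHom M (s.map X).prod = (s.map (hFY M)).prod := by
  rw [map_multiset_prod, Multiset.map_map]
  congr 1
  exact Multiset.map_congr rfl fun F _ => simplicialHom_X M F

lemma isHomogeneous_prod_map_X {σ : Type*} (s : Multiset σ) :
    ((s.map X).prod : MvPolynomial σ ℝ).IsHomogeneous s.card := by
  induction s using Multiset.induction_on with
  | empty => simpa using isHomogeneous_one σ ℝ
  | cons a s ih =>
    rw [Multiset.map_cons, Multiset.prod_cons, Multiset.card_cons, add_comm]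
    exact (isHomogeneous_X ℝ a).mul ih

lemma hFY_groundFlat_pow_eq (M : Matroid α) {d : ℕ} (hM : M.eRank = (d : ℕ∞) + 1) :
    hFY M (groundFlat hM) ^ d =
      simplicialHom M ((Multiset.replicate d (groundFlat hM)).map X).prod := by
  rw [simplicialHom_prod, Multiset.map_replicate, Multiset.prod_replicate]

/-- A functional with the values of the dragon functional is a degree map. -/
lemma isDegreeMap_of_apply {M : Matroid α} [M.Loopless] {d : ℕ} (hM : M.eRank = (d : ℕ∞) + 1)
    {deg : ChowFY M →ₗ[ℝ] ℝ} (hdeg : ∀ p, deg (Ideal.Quotient.mkₐ ℝ (chowIdeal M) p) =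
      dragonFunctional M d (toSimplicial M p)) : IsDegreeMap M d deg := by
  constructor
  · rintro k hk _ ⟨p, hp, rfl⟩
    refine (hdeg p).trans ?_
    exact dragonFunctional_eq_zero_of_isHomogeneous M hk (isHomogeneous_toSimplicial hp)
  · intro F hF hFE
    rw [prod_z_eq_hFY_pow hM hF hFE, hFY_groundFlat_pow_eq, ← mk_ofSimplicial, hdeg,
      toSimplicial_ofSimplicial, dragonFunctional_prod, Multiset.card_replicate, if_pos rfl,
      Multiset.map_replicate]
    exact dragonIndicator_replicate_ground M hM

/-- Degree maps are unique, since the part of degree `d` is spanned by `h_E ^ d`, on which every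
degree map takes the value `1`. -/
lemma IsDegreeMap.unique {M : Matroid α} [M.Loopless] {d : ℕ} (hM : M.eRank = (d : ℕ∞) + 1)
    {f g : ChowFY M →ₗ[ℝ] ℝ} (hf : IsDegreeMap M d f) (hg : IsDegreeMap M d g) : f = g := by
  have htop {f : ChowFY M →ₗ[ℝ] ℝ} (hf : IsDegreeMap M d f) :
      f (hFY M (groundFlat hM) ^ d) = 1 := by
    obtain ⟨F, hF, hFE⟩ := exists_strictMono_flat hM
    rw [← prod_z_eq_hFY_pow hM hF hFE]
    exact hf.2 F hF hFE
  have hcomp : f ∘ₗ (simplicialHom M).toLinearMap = g ∘ₗ (simplicialHom M).toLinearMap := by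
    refine eq_of_prod_map_X fun s => ?_
    change f (simplicialHom M _) = g (simplicialHom M _)
    by_cases hs : s.card = d
    · obtain ⟨c, hc⟩ := exists_prod_hFY_eq_smul hM s hs
      rw [simplicialHom_prod, hc, map_smul, map_smul, htop hf, htop hg]
    · have hmem := simplicialHom_mem_gradedPiece (isHomogeneous_prod_map_X s)
      rw [hf.1 _ hs _ hmem, hg.1 _ hs _ hmem]
  refine LinearMap.ext fun ξ => ?_
  obtain ⟨p, rfl⟩ := Ideal.Quotient.mkₐ_surjective ℝ (chowIdeal M) ξ
  rw [← simplicialHom_toSimplicial]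
  exact DFunLike.congr_fun hcomp (toSimplicial M p)

theorem existsUnique_isDegreeMap (M : Matroid α) [M.Loopless] {d : ℕ}
    (hM : M.eRank = (d : ℕ∞) + 1) : ∃! deg : ChowFY M →ₗ[ℝ] ℝ, IsDegreeMap M d deg := by
  obtain ⟨deg, hdeg⟩ := exists_descent M d
  exact ⟨deg, isDegreeMap_of_apply hM hdeg,
    fun _ h => IsDegreeMap.unique hM h (isDegreeMap_of_apply hM hdeg)⟩

lemma degreeMap_simplicialHom (M : Matroid α) [M.Loopless] {d : ℕ}
    (hM : M.eRank = (d : ℕ∞) + 1) (p : MvPolynomial (NonemptyFlat M) ℝ) :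
    degreeMap M d (simplicialHom M p) = dragonFunctional M d p := by
  obtain ⟨deg, hdeg⟩ := exists_descent M d
  have hspec : IsDegreeMap M d (degreeMap M d) :=
    Classical.epsilon_spec ⟨deg, isDegreeMap_of_apply hM hdeg⟩
  rw [IsDegreeMap.unique hM hspec (isDegreeMap_of_apply hM hdeg), ← mk_ofSimplicial, hdeg,
    toSimplicial_ofSimplicial]

/-- Products of simplicial generators have degree `1` or `0`, according to the dragon Hall-Rado
condition. -/
lemma simplicialDegree_prod (M : Matroid α) [M.Loopless] {d : ℕ}
    (hM : M.eRank = (d : ℕ∞) + 1) (s : Multiset (NonemptyFlat M)) (hs : s.card = d) :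
    simplicialDegree M d (s.map (h M)).prod = dragonIndicator M (s.map Subtype.val) := by
  have hmk : (s.map (h M)).prod =
      Ideal.Quotient.mk (RingHom.ker (simplicialHom M)) (s.map X).prod := by
    rw [map_multiset_prod, Multiset.map_map]
    rfl
  have := (degreeMap_simplicialHom M hM (s.map X).prod).trans (dragonFunctional_prod M d s)
  rw [if_pos hs] at this
  rw [hmk, ← this]
  rfl

/-! ### Volume polynomials -/

lemma mapCoeff_eq_finsuppSum {A ι : Type*} [CommRing A] [Algebra ℝ A] (φ : A →ₗ[ℝ] ℝ)
    (p : MvPolynomial ι A) {S : Finset (ι →₀ ℕ)} (hS : p.support ⊆ S) :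
    mapCoeff φ p = ∑ m ∈ S, monomial m (φ (p.coeff m)) := by
  refine Finset.sum_subset hS fun m _ hm => ?_
  rw [notMem_support_iff.1 hm, map_zero, map_zero]

lemma mapCoeff_add {A ι : Type*} [CommRing A] [Algebra ℝ A] (φ : A →ₗ[ℝ] ℝ)
    (p q : MvPolynomial ι A) : mapCoeff φ (p + q) = mapCoeff φ p + mapCoeff φ q := by
  rw [mapCoeff_eq_finsuppSum φ (p + q) support_add,
    mapCoeff_eq_finsuppSum φ p Finset.subset_union_left,
    mapCoeff_eq_finsuppSum φ q Finset.subset_union_right, ← Finset.sum_add_distrib]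
  simp

lemma mapCoeff_sum {A ι κ : Type*} [CommRing A] [Algebra ℝ A] (φ : A →ₗ[ℝ] ℝ) (s : Finset κ)
    (p : κ → MvPolynomial ι A) : mapCoeff φ (∑ k ∈ s, p k) = ∑ k ∈ s, mapCoeff φ (p k) := by
  induction s using Finset.induction_on with
  | empty => simp [mapCoeff]
  | insert a s ha ih => rw [Finset.sum_insert ha, Finset.sum_insert ha, mapCoeff_add, ih]

lemma mapCoeff_monomial {A ι : Type*} [CommRing A] [Algebra ℝ A] (φ : A →ₗ[ℝ] ℝ)
    (m : ι →₀ ℕ) (a : A) : mapCoeff φ (monomial m a) = monomial m (φ a) := by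
  rw [mapCoeff_eq_finsuppSum φ _ support_monomial_subset]
  simp

lemma prod_map_X_mul_C {A ι : Type*} [CommRing A] [DecidableEq ι] (s : Multiset ι) (f : ι → A) :
    (s.map fun i => X i * C (f i)).prod = monomial (Multiset.toFinsupp s) (s.map f).prod := by
  induction s using Multiset.induction_on with
  | empty => simp
  | cons a s ih =>
    rw [Multiset.map_cons, Multiset.prod_cons, ih, ← Multiset.singleton_add, map_add,
      Multiset.toFinsupp_singleton, Multiset.singleton_add, Multiset.map_cons, Multiset.prod_cons,
      mul_comm (X a), C_mul_X_eq_monomial, monomial_mul]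

/-- The volume polynomial as a sum over ordered tuples. -/
lemma volumePolynomial_eq_sum (M : Matroid α) [M.Loopless] {d : ℕ}
    (hM : M.eRank = (d : ℕ∞) + 1) {ι : Type*} [Fintype ι] (F : ι → NonemptyFlat M) :
    volumePolynomial M d F =
      ∑ f : Fin d → ι with DragonHallRado M (fun i => (F (f i)).1), ∏ i, X (f i) := by
  rw [volumePolynomial, Fintype.sum_pow, mapCoeff_sum, Finset.sum_filter]
  refine Finset.sum_congr rfl fun f _ => ?_
  have hmap : ∏ i, X (f i) * C (h M (F (f i))) =
      ((Finset.univ.val.map f).map fun i => X i * C (h M (F i))).prod := by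
    rw [Multiset.map_map]
    rfl
  have hX : (∏ i, X (f i) : MvPolynomial ι ℝ) = ((Finset.univ.val.map f).map X).prod := by
    rw [Multiset.map_map]
    rfl
  rw [hmap, prod_map_X_mul_C, mapCoeff_monomial, hX, prod_map_X_eq_monomial]
  have := simplicialDegree_prod M hM ((Finset.univ.val.map f).map F) (by simp)
  rw [Multiset.map_map] at this
  rw [Function.comp_def] at this
  rw [this, dragonIndicator, dragonHallRado_iff_multiset]
  simp only [Multiset.map_map, Function.comp_def]
  split_ifs <;> simp

/-- The volume polynomial as a sum over multisets. -/
lemma volumePolynomial_eq_sum_sym (M : Matroid α) [M.Loopless] {d : ℕ}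
    (hM : M.eRank = (d : ℕ∞) + 1) {ι : Type*} [Fintype ι] [DecidableEq ι] (F : ι → NonemptyFlat M) :
    volumePolynomial M d F =
      ∑ s : Sym ι d with DragonHallRadoMultiset M (s.1.map fun i => (F i).1),
        Nat.multinomial s.1.toFinset (fun i => s.1.count i) •
          ∏ i ∈ s.1.toFinset, X i ^ s.1.count i := by
  rw [volumePolynomial, Finset.sum_pow, mapCoeff_sum, Finset.sum_filter, Finset.sym_univ]
  refine Finset.sum_congr rfl fun s _ => ?_
  rw [prod_map_X_mul_C, ← nsmul_eq_mul, ← map_nsmul (monomial _), mapCoeff_monomial,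
    map_nsmul (simplicialDegree M d), map_nsmul (monomial _)]
  have hcount : s.1.countPerms = Nat.multinomial s.1.toFinset fun i => s.1.count i := by
    rw [Multiset.countPerms, Finsupp.multinomial_eq, Multiset.toFinsupp_support]
    exact Nat.multinomial_congr fun i _ => Multiset.toFinsupp_apply _ _
  have := simplicialDegree_prod M hM (s.1.map F) (by simp)
  rw [Multiset.map_map, Multiset.map_map] at this
  simp only [Function.comp_def] at this
  rw [hcount, ← Finset.prod_multiset_map_count, prod_map_X_eq_monomial, this, dragonIndicator]
  split_ifs <;> simp

end MatroidChow

end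

theorem mainTheorem7 :
    (∀ {α : Type*} [Fintype α] (M : Matroid α) [M.Loopless] (d : ℕ), M.eRank = (d : ℕ∞) + 1 →
      -- the degree map is well defined
      (∃! deg : MatroidChow.ChowFY M →ₗ[ℝ] ℝ, MatroidChow.IsDegreeMap M d deg) ∧
      -- variables indexed by all nonempty flats
      MatroidChow.volumePolynomial M d (fun F : MatroidChow.NonemptyFlat M => F) =
        ∑ F : Fin d → MatroidChow.NonemptyFlat M with
          MatroidChow.DragonHallRado M (fun i => (F i).1),
          ∏ i, MvPolynomial.X (F i) ∧
      MatroidChow.volumePolynomial M d (fun F : MatroidChow.NonemptyFlat M => F) =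
        ∑ s : Sym (MatroidChow.NonemptyFlat M) d with
          MatroidChow.DragonHallRadoMultiset M (s.1.map fun F => F.1),
          Nat.multinomial s.1.toFinset (fun F => s.1.count F) •
            ∏ F ∈ s.1.toFinset, MvPolynomial.X F ^ s.1.count F ∧
      -- variables indexed by the flats of rank at least two
      MatroidChow.volumePolynomial M d (fun F : MatroidChow.FlatGeTwo M => F.1) =
        ∑ F : Fin d → MatroidChow.FlatGeTwo M with
          MatroidChow.DragonHallRado M (fun i => (F i).1.1),
          ∏ i, MvPolynomial.X (F i) ∧
      MatroidChow.volumePolynomial M d (fun F : MatroidChow.FlatGeTwo M => F.1) =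
        ∑ s : Sym (MatroidChow.FlatGeTwo M) d with
          MatroidChow.DragonHallRadoMultiset M (s.1.map fun F => F.1.1),
          Nat.multinomial s.1.toFinset (fun F => s.1.count F) •
            ∏ F ∈ s.1.toFinset, MvPolynomial.X F ^ s.1.count F) ∧
    -- the Boolean matroid, variables indexed by the nonempty subsets of {0, ..., n}
    (∀ n : ℕ,
      MatroidChow.volumePolynomial (MatroidChow.boolean n) n (MatroidChow.booleanFlat n) =
        ∑ S : Fin n → {S : Finset (Fin (n + 1)) // S.Nonempty} with
          ∀ J : Finset (Fin n), J.Nonempty → J.card + 1 ≤ (J.biUnion fun j => (S j).1).card,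
          ∏ i, MvPolynomial.X (S i)) := by
  refine ⟨fun M _ d hM => ⟨MatroidChow.existsUnique_isDegreeMap M hM,
    MatroidChow.volumePolynomial_eq_sum M hM _, MatroidChow.volumePolynomial_eq_sum_sym M hM _,
    MatroidChow.volumePolynomial_eq_sum M hM _, MatroidChow.volumePolynomial_eq_sum_sym M hM _⟩,
    fun n => ?_⟩
  have hM : (MatroidChow.boolean n).eRank = (n : ℕ∞) + 1 := by simp
  have : (MatroidChow.boolean n).Loopless := by
    simp [Matroid.loopless_iff_forall_isNonloop, ← Matroid.indep_singleton]
  rw [MatroidChow.volumePolynomial_eq_sum _ hM]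
  refine Finset.sum_congr (Finset.filter_congr fun S _ => forall₂_congr fun J _ => ?_)
    fun _ _ => rfl
  have hunion : (⋃ j ∈ J, (MatroidChow.booleanFlat n (S j)).1) =
      ((J.biUnion fun j => (S j).1 : Finset (Fin (n + 1))) : Set (Fin (n + 1))) := by
    ext x
    simp [MatroidChow.booleanFlat]
  rw [hunion, Matroid.eRk_freeOn (Set.subset_univ _), Set.encard_coe_eq_coe_finsetCard]
  exact_mod_cast Iff.rfl
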